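/- **Setting.** Let $\mathsf H$ be a locally compact (Hausdorff) Abelian group and $\Sigma\subset \mathsf H\times\mathbb R^d$ a countable, discrete, co-compact subgroup such that the projection to $\mathbb R^d$ is injective on $\Sigma$, with image denoted $\Gamma$, and the projection of $\Sigma$ to $\mathsf H$ is dense (a *cut-and-project scheme*). Let $W\subset\mathsf H$ be a *window*: a non-empty compact set with $W=\overline{\mathring W}$ and such that $W+w=W$ only for $w=0$. For $A\subset\mathsf H$ let $\mathfrak P(A)\subset\Gamma$ be the projection to $\mathbb R^d$ of $\Sigma\cap(A\times\mathbb R^d)$. A *non-singular model set* is a set $\Lambda\subset\mathbb R^d$ with $\mathfrak P(w+\mathring W)-t=\Lambda=\mathfrak P(w+W)-t$ for some $(w,t)\in \mathsf H\times\mathbb R^d$. The *language* of $\Lambda\subset\mathbb R^d$ is $\mathcal L_\Lambda=\{(\Lambda-\gamma)\cap B(0,R) : \gamma\in\Lambda,\ R>0\}$. The *hull* $\mathbb X$ is the set of all $\Lambda\subset\mathbb R^d$ whose language is that of the non-singular model sets. It is equipped with the topology in which the sets $$\{\Lambda'\in\mathbb X : \exists\,|t|,|t'|<\varepsilon,\ (\Lambda-t)\cap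 K=(\Lambda'-t')\cap K\},\qquad K\subset\mathbb R^d \text{ compact},\ \varepsilon>0,$$ form a neighbourhood basis of $\Lambda$, and with the action $\Lambda.t=\Lambda-t$ of $\mathbb R^d$. The *internal system* is $\Xi^\Gamma=\{\Lambda\in\mathbb X:\Lambda\subset\Gamma\}$, with the action of $\Gamma$ by translation and with the (finer) topology in which the sets $\{\Lambda'\in\Xi^\Gamma:\Lambda\cap K=\Lambda'\cap K\}$, $K$ compact, form a neighbourhood basis of $\Lambda$. For a group $T$ acting by homeomorphisms on a space $Y$, the *Ellis semigroup* $E(Y,T)$ is the closure in $Y^Y$, for pointwise convergence, of the set of homeomorphisms given by $T$; it carries the topology of pointwise convergence and the product $g.h$ = first $g$, then $h$. Every $\Lambda_0\in\mathbb X$ can be written $\Lambda_0=\Lambda-t$ with $\Lambda\in\Xi^\Gamma$, $t\in\mathbb R^d$, and for $g\in E(\Xi^\Gamma,\Gamma)$ the map $\tilde g:\mathbb X\to\mathbb X$, $(\Lambda-t).\tilde g:=\Lambda.g-t$, is well defined. Let $E(\Xi^\Gamma,\Gamma)\times_\Gamma\mathbb R^d$ be the quotient semigroup of $E(\Xi^\Gamma,\Gamma)\times\mathbb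 R^d$, with the quotient topology, under the congruence identifying $(g,t)$ with $(g+\gamma,t+\gamma)$ for all $\gamma\in\Gamma$, where $g+\gamma$ is the map $\Lambda\mapsto\Lambda.g+\gamma$; write $[g,t]_\Gamma$ for the class of $(g,t)$. **Theorem.** For every cut-and-project scheme $(\mathsf H,\Sigma,\mathbb R^d)$ and every window, there is a map $$E(\Xi^\Gamma,\Gamma)\times_\Gamma\mathbb R^d\longrightarrow E(\mathbb X,\mathbb R^d)$$ which sends each $[g,t]_\Gamma$ to $\tilde g-t$, that is, to the transformation $\Lambda\mapsto\Lambda.\tilde g-t$ of $\mathbb X$, and this map is an isomorphism of semigroups and a homeomorphism. -/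

import Mathlib

open scoped Pointwise

/-! ### Ellis semigroups -/

section Ellis

/-- The underlying set of the Ellis semigroup `E(X,T)`: the closure, for the topology of pointwise
convergence on `X → X` (product topology), of the set of maps `x ↦ x.t`, `t ∈ T`. -/
def ellisSet (T X : Type*) [AddGroup T] [AddAction T X] [TopologicalSpace X] : Set (X → X) :=
  closure (Set.range fun (t : T) (x : X) => t +ᵥ x)

/-- The Ellis semigroup `E(X,T)`, with the topology of pointwise convergence. -/
def EllisSemigroup (T X : Type*) [AddGroup T] [AddAction T X] [TopologicalSpace X] : Type _ :=
  ↥(ellisSet T X)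

variable {T X : Type*} [AddGroup T] [AddAction T X] [TopologicalSpace X]

namespace EllisSemigroup

instance : CoeFun (EllisSemigroup T X) (fun _ => X → X) := ⟨Subtype.val⟩

instance : TopologicalSpace (EllisSemigroup T X) :=
  inferInstanceAs (TopologicalSpace ↥(ellisSet T X))

theorem ext {g h : EllisSemigroup T X} (H : ∀ x, g x = h x) : g = h :=
  Subtype.ext (funext H)

/-- The element of `E(X,T)` given by the action of `t ∈ T`. -/
def ofGroup (t : T) : EllisSemigroup T X :=
  ⟨fun x => t +ᵥ x, subset_closure ⟨t, rfl⟩⟩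

variable [ContinuousConstVAdd T X]

theorem comp_mem {g h : X → X} (hg : g ∈ ellisSet T X) (hh : h ∈ ellisSet T X) :
    h ∘ g ∈ ellisSet T X := by
  have h1 : ∀ t : T, (fun x => t +ᵥ g x) ∈ ellisSet T X := by
    intro t
    refine map_mem_closure (f := fun k : X → X => fun x => t +ᵥ k x) ?_ hg ?_
    · exact continuous_pi fun x => (continuous_apply x).const_vadd t
    · rintro _ ⟨s, rfl⟩
      exact ⟨t + s, funext fun x => add_vadd t s x⟩
  have h2 : h ∘ g ∈ closure (ellisSet T X) := by
    refine map_mem_closure (f := fun k : X → X => k ∘ g) ?_ hh ?_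
    · exact continuous_pi fun x => continuous_apply (g x)
    · rintro _ ⟨t, rfl⟩
      exact h1 t
  rwa [ellisSet, closure_closure] at h2

/-- The composition law of `E(X,T)`: transformations act on the right, so that `g * h` is
`x ↦ (x.g).h`, that is, first `g` and then `h`. -/
instance : Monoid (EllisSemigroup T X) where
  mul g h := ⟨fun x => h (g x), comp_mem g.2 h.2⟩
  one := ⟨fun x => x, subset_closure ⟨0, funext fun x => zero_vadd T x⟩⟩
  mul_assoc _ _ _ := rfl
  one_mul _ := rfl
  mul_one _ := rfl

theorem mul_apply (g h : EllisSemigroup T X) (x : X) : (g * h) x = h (g x) := rfl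

/-- For a commutative group acting on a Hausdorff space, the elements of the Ellis semigroup
commute with the action. -/
theorem map_vadd {T X : Type*} [AddCommGroup T] [AddAction T X] [TopologicalSpace X]
    [ContinuousConstVAdd T X] [T2Space X] (g : EllisSemigroup T X) (t : T) (x : X) :
    g (t +ᵥ x) = t +ᵥ g x := by
  have hc : IsClosed {k : X → X | k (t +ᵥ x) = t +ᵥ k x} :=
    isClosed_eq (continuous_apply _) ((continuous_apply x).const_vadd t)
  refine closure_minimal ?_ hc g.2
  rintro _ ⟨s, rfl⟩
  exact vadd_comm s t x

end EllisSemigroup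

end Ellis

/-! ### Cut-and-project schemes, windows, point patterns -/

/-- The physical space `ℝ^d`. -/
abbrev PhysicalSpace (d : ℕ) : Type := EuclideanSpace ℝ (Fin d)

/-- A cut-and-project scheme `(H, Σ, ℝ^d)`: `Σ` is a countable, discrete and co-compact subgroup of
`H × ℝ^d`, which projects injectively to `ℝ^d` and has dense projection to `H`. -/
structure CutProjectScheme (H : Type*) [AddCommGroup H] [TopologicalSpace H] (d : ℕ) where
  lattice : AddSubgroup (H × PhysicalSpace d)
  countable : Countable lattice
  discrete : DiscreteTopology lattice
  cocompact : CompactSpace ((H × PhysicalSpace d) ⧸ lattice)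
  injOn_snd : Set.InjOn Prod.snd (lattice : Set (H × PhysicalSpace d))
  dense_fst : Dense (Prod.fst '' (lattice : Set (H × PhysicalSpace d)))

/-- A window: a non-empty compact subset which is topologically regular (the closure of its
interior) and irredundant (no non-trivial translation preserves it). -/
structure Window (H : Type*) [AddCommGroup H] [TopologicalSpace H] where
  carrier : Set H
  nonempty : carrier.Nonempty
  isCompact : IsCompact carrier
  regular : closure (interior carrier) = carrier
  irredundant : ∀ w : H, w +ᵥ carrier = carrier → w = 0

/-- The translated point pattern `Λ - t`. -/
def translatePattern {d : ℕ} (Λ : Set (PhysicalSpace d)) (t : PhysicalSpace d) :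
    Set (PhysicalSpace d) :=
  {x | x + t ∈ Λ}

/-- The language of a point pattern: all `(Λ - γ) ∩ B(0,R)` with `γ ∈ Λ` and `R > 0`. -/
def patternLanguage {d : ℕ} (Λ : Set (PhysicalSpace d)) : Set (Set (PhysicalSpace d)) :=
  {P | ∃ γ ∈ Λ, ∃ R : ℝ, 0 < R ∧ P = translatePattern Λ γ ∩ Metric.closedBall 0 R}

section CutProject

variable {H : Type*} [AddCommGroup H] [TopologicalSpace H] {d : ℕ}

/-- The structure group `Γ`: the projection of the lattice `Σ` to `ℝ^d`. -/
def CutProjectScheme.structureGroup (S : CutProjectScheme H d) : AddSubgroup (PhysicalSpace d) :=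
  S.lattice.map (AddMonoidHom.snd H (PhysicalSpace d))

/-- The point pattern `𝔓(A)`: the projection to `ℝ^d` of the points of `Σ` in the strip
`A × ℝ^d`; that is, all `γ ∈ Γ` with `γ* ∈ A`. -/
def CutProjectScheme.pattern (S : CutProjectScheme H d) (A : Set H) : Set (PhysicalSpace d) :=
  Prod.snd '' ((S.lattice : Set (H × PhysicalSpace d)) ∩ A ×ˢ Set.univ)

/-- Non-singular model sets: `𝔓(w + int W) - t = Λ = 𝔓(w + W) - t` for some `w ∈ H`,
`t ∈ ℝ^d`. -/
def IsNonSingularModelSet (S : CutProjectScheme H d) (W : Window H) (Λ : Set (PhysicalSpace d)) :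
    Prop :=
  ∃ (w : H) (t : PhysicalSpace d),
    translatePattern (S.pattern (w +ᵥ interior W.carrier)) t = Λ ∧
    Λ = translatePattern (S.pattern (w +ᵥ W.carrier)) t

/-- The hull `𝕏`: all point patterns of `ℝ^d` with the same language as the non-singular model
sets. -/
@[ext]
structure Hull (S : CutProjectScheme H d) (W : Window H) where
  carrier : Set (PhysicalSpace d)
  language_eq : ∃ Λ' : Set (PhysicalSpace d),
    IsNonSingularModelSet S W Λ' ∧ patternLanguage carrier = patternLanguage Λ'

/-- The internal system `Ξ^Γ`: all `Λ ∈ 𝕏` with `Λ ⊆ Γ`. -/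
@[ext]
structure InternalSystem (S : CutProjectScheme H d) (W : Window H) where
  toHull : Hull S W
  subset : toHull.carrier ⊆ S.structureGroup

variable {S : CutProjectScheme H d} {W : Window H}

theorem mem_structureGroup_of_mem_pattern {A : Set H} {x : PhysicalSpace d}
    (hx : x ∈ S.pattern A) : x ∈ S.structureGroup := by
  obtain ⟨p, ⟨hp, -⟩, rfl⟩ := hx
  exact ⟨p, hp, rfl⟩

theorem translatePattern_add (Λ : Set (PhysicalSpace d)) (s t : PhysicalSpace d) :
    translatePattern Λ (s + t) = translatePattern (translatePattern Λ t) s := by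
  ext x
  simp [translatePattern, add_assoc]

theorem patternLanguage_translate (Λ : Set (PhysicalSpace d)) (t : PhysicalSpace d) :
    patternLanguage (translatePattern Λ t) = patternLanguage Λ := by
  ext P
  constructor
  · rintro ⟨γ, hγ, R, hR, rfl⟩
    exact ⟨γ + t, hγ, R, hR, by rw [translatePattern_add]⟩
  · rintro ⟨γ, hγ, R, hR, rfl⟩
    refine ⟨γ - t, by simpa [translatePattern] using hγ, R, hR, ?_⟩
    rw [← translatePattern_add, sub_add_cancel]

/-! ### The dynamical systems `(𝕏, ℝ^d)` and `(Ξ^Γ, Γ)` -/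

/-- The action of `ℝ^d` on the hull, `Λ.t = Λ - t`. -/
instance : AddAction (PhysicalSpace d) (Hull S W) where
  vadd t Λ := ⟨translatePattern Λ.carrier t, by
    rw [patternLanguage_translate]; exact Λ.language_eq⟩
  zero_vadd Λ := Hull.ext (by
    change translatePattern Λ.carrier 0 = Λ.carrier
    simp [translatePattern])
  add_vadd s t Λ := Hull.ext (translatePattern_add Λ.carrier s t)

theorem Hull.mem_vadd {t x : PhysicalSpace d} {Λ : Hull S W} :
    x ∈ (t +ᵥ Λ).carrier ↔ x + t ∈ Λ.carrier := Iff.rfl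

/-- The action of `Γ` on the internal system, `Λ.γ = Λ - γ`. -/
instance : AddAction S.structureGroup (InternalSystem S W) where
  vadd γ Λ := ⟨(γ : PhysicalSpace d) +ᵥ Λ.toHull, fun x hx => by
    have h := S.structureGroup.sub_mem (Λ.subset (Hull.mem_vadd.1 hx)) γ.2
    rwa [add_sub_cancel_right] at h⟩
  zero_vadd Λ := InternalSystem.ext (zero_vadd (PhysicalSpace d) Λ.toHull)
  add_vadd s t Λ :=
    InternalSystem.ext (add_vadd (s : PhysicalSpace d) (t : PhysicalSpace d) Λ.toHull)

theorem InternalSystem.toHull_vadd (γ : S.structureGroup) (Λ : InternalSystem S W) :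
    (γ +ᵥ Λ).toHull = (γ : PhysicalSpace d) +ᵥ Λ.toHull := rfl

theorem inter_eq_of_subset {α : Type*} {A B K L : Set α} (hKL : K ⊆ L) (h : A ∩ L = B ∩ L) :
    A ∩ K = B ∩ K := by
  rw [← Set.inter_eq_self_of_subset_right hKL, ← Set.inter_assoc, h, Set.inter_assoc]

/-- The basic neighbourhood `𝒰_{K,ε}(Λ)` in the hull: all `Λ' ∈ 𝕏` such that
`(Λ - t) ∩ K = (Λ' - t') ∩ K` for some `|t|, |t'| < ε`. -/
def Hull.basicNhd (Λ : Hull S W) (K : Set (PhysicalSpace d)) (ε : ℝ) : Set (Hull S W) :=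
  {Λ' | ∃ t t' : PhysicalSpace d, ‖t‖ < ε ∧ ‖t'‖ < ε ∧
    translatePattern Λ.carrier t ∩ K = translatePattern Λ'.carrier t' ∩ K}

/-- The topology of the hull: the `𝒰_{K,ε}(Λ)`, with `K` compact and `ε > 0`, form a basis of
neighbourhoods of `Λ`. -/
instance : TopologicalSpace (Hull S W) where
  IsOpen U := ∀ Λ ∈ U, ∃ K : Set (PhysicalSpace d), IsCompact K ∧ ∃ ε : ℝ, 0 < ε ∧
    Λ.basicNhd K ε ⊆ U
  isOpen_univ _ _ := ⟨∅, isCompact_empty, 1, one_pos, Set.subset_univ _⟩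
  isOpen_inter U V hU hV Λ hΛ := by
    obtain ⟨K, hK, ε, hε, h⟩ := hU Λ hΛ.1
    obtain ⟨L, hL, δ, hδ, h'⟩ := hV Λ hΛ.2
    refine ⟨K ∪ L, hK.union hL, min ε δ, lt_min hε hδ, ?_⟩
    rintro Λ' ⟨t, t', ht, ht', e⟩
    refine ⟨h ⟨t, t', ht.trans_le (min_le_left _ _), ht'.trans_le (min_le_left _ _), ?_⟩,
      h' ⟨t, t', ht.trans_le (min_le_right _ _), ht'.trans_le (min_le_right _ _), ?_⟩⟩
    · exact inter_eq_of_subset Set.subset_union_left e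
    · exact inter_eq_of_subset Set.subset_union_right e
  isOpen_sUnion 𝒮 h𝒮 Λ hΛ := by
    obtain ⟨U, hU, hΛU⟩ := hΛ
    obtain ⟨K, hK, ε, hε, h⟩ := h𝒮 U hU Λ hΛU
    exact ⟨K, hK, ε, hε, h.trans (Set.subset_sUnion_of_mem hU)⟩

/-- The basic neighbourhood `𝒰_K(Λ)` in the internal system: all `Λ' ∈ Ξ^Γ` such that
`Λ ∩ K = Λ' ∩ K`. -/
def InternalSystem.basicNhd (Λ : InternalSystem S W) (K : Set (PhysicalSpace d)) :
    Set (InternalSystem S W) :=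
  {Λ' | Λ.toHull.carrier ∩ K = Λ'.toHull.carrier ∩ K}

/-- The topology of the internal system: the `𝒰_K(Λ)`, with `K` compact, form a basis of
neighbourhoods of `Λ`. (This is finer than the topology induced by the hull.) -/
instance : TopologicalSpace (InternalSystem S W) where
  IsOpen U := ∀ Λ ∈ U, ∃ K : Set (PhysicalSpace d), IsCompact K ∧ Λ.basicNhd K ⊆ U
  isOpen_univ _ _ := ⟨∅, isCompact_empty, Set.subset_univ _⟩
  isOpen_inter U V hU hV Λ hΛ := by
    obtain ⟨K, hK, h⟩ := hU Λ hΛ.1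
    obtain ⟨L, hL, h'⟩ := hV Λ hΛ.2
    refine ⟨K ∪ L, hK.union hL, fun Λ' e => ⟨h ?_, h' ?_⟩⟩
    · exact inter_eq_of_subset Set.subset_union_left e
    · exact inter_eq_of_subset Set.subset_union_right e
  isOpen_sUnion 𝒮 h𝒮 Λ hΛ := by
    obtain ⟨U, hU, hΛU⟩ := hΛ
    obtain ⟨K, hK, h⟩ := h𝒮 U hU Λ hΛU
    exact ⟨K, hK, h.trans (Set.subset_sUnion_of_mem hU)⟩

theorem isCompact_translatePattern {K : Set (PhysicalSpace d)} (hK : IsCompact K)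
    (t : PhysicalSpace d) : IsCompact (translatePattern K t) :=
  (Homeomorph.addRight t).isCompact_preimage.2 hK

instance : ContinuousConstVAdd (PhysicalSpace d) (Hull S W) where
  continuous_const_vadd s := ⟨fun U hU Λ hΛ => by
    obtain ⟨K, hK, ε, hε, h⟩ := hU (s +ᵥ Λ) hΛ
    refine ⟨translatePattern K (-s), isCompact_translatePattern hK _, ε, hε, ?_⟩
    rintro Λ' ⟨t, t', ht, ht', e⟩
    refine h ⟨t, t', ht, ht', ?_⟩
    ext x
    have := Set.ext_iff.1 e (x + s)
    simpa [translatePattern, Hull.mem_vadd, add_right_comm] using this⟩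

instance : ContinuousConstVAdd S.structureGroup (InternalSystem S W) where
  continuous_const_vadd s := ⟨fun U hU Λ hΛ => by
    obtain ⟨K, hK, h⟩ := hU (s +ᵥ Λ) hΛ
    refine ⟨translatePattern K (-(s : PhysicalSpace d)), isCompact_translatePattern hK _, ?_⟩
    intro Λ' e
    refine h ?_
    change _ ∩ _ = _ ∩ _
    ext x
    have := Set.ext_iff.1 e (x + s)
    simpa [translatePattern, InternalSystem.toHull_vadd, Hull.mem_vadd] using this⟩

theorem InternalSystem.isOpen_basicNhd (Λ : InternalSystem S W) {K : Set (PhysicalSpace d)}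
    (hK : IsCompact K) : IsOpen (Λ.basicNhd K) :=
  fun _ h => ⟨K, hK, fun _ h' => Eq.trans h h'⟩

instance : T2Space (InternalSystem S W) where
  t2 Λ Λ' hne := by
    obtain ⟨x, hx⟩ : ∃ x, ¬ (x ∈ Λ.toHull.carrier ↔ x ∈ Λ'.toHull.carrier) := by
      by_contra! h
      exact hne (InternalSystem.ext (Hull.ext (Set.ext h)))
    refine ⟨Λ.basicNhd {x}, Λ'.basicNhd {x}, Λ.isOpen_basicNhd isCompact_singleton,
      Λ'.isOpen_basicNhd isCompact_singleton, rfl, rfl, ?_⟩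
    rw [Set.disjoint_left]
    intro M h h'
    have := Set.ext_iff.1 (Eq.trans h (Eq.symm h')) x
    simp at this
    exact hx this

/-! ### The extension `g̃` of `g ∈ E(Ξ^Γ, Γ)` to the hull -/

theorem Hull.carrier_nonempty [IsTopologicalAddGroup H] (Λ : Hull S W) : Λ.carrier.Nonempty := by
  obtain ⟨Λ', ⟨w, t, h, -⟩, hl⟩ := Λ.language_eq
  have hW : (interior W.carrier).Nonempty := by
    rw [← closure_nonempty_iff, W.regular]; exact W.nonempty
  obtain ⟨y, hy, p, hp, rfl⟩ :=
    S.dense_fst.inter_open_nonempty (w +ᵥ interior W.carrier) (isOpen_interior.vadd w)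
      (hW.vadd_set)
  have hx : p.2 - t ∈ Λ' := by
    rw [← h]
    change p.2 - t + t ∈ S.pattern (w +ᵥ interior W.carrier)
    rw [sub_add_cancel]
    exact ⟨p, ⟨hp, hy, trivial⟩, rfl⟩
  have : translatePattern Λ' (p.2 - t) ∩ Metric.closedBall 0 1 ∈ patternLanguage Λ.carrier := by
    rw [hl]; exact ⟨_, hx, 1, one_pos, rfl⟩
  obtain ⟨γ, hγ, -⟩ := this
  exact ⟨γ, hγ⟩

/-- Differences of points of a pattern in the hull lie in `Γ`. -/
theorem Hull.sub_mem (Λ : Hull S W) {x y : PhysicalSpace d} (hx : x ∈ Λ.carrier)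
    (hy : y ∈ Λ.carrier) : y - x ∈ S.structureGroup := by
  obtain ⟨Λ', ⟨w, t, h, -⟩, hl⟩ := Λ.language_eq
  have hP : translatePattern Λ.carrier x ∩ Metric.closedBall 0 (‖y - x‖ + 1)
      ∈ patternLanguage Λ' := by
    rw [← hl]; exact ⟨x, hx, _, by positivity, rfl⟩
  obtain ⟨γ, hγ, R, -, hR⟩ := hP
  have hm : y - x ∈ translatePattern Λ.carrier x ∩ Metric.closedBall 0 (‖y - x‖ + 1) := by
    refine ⟨?_, by simp⟩
    change y - x + x ∈ Λ.carrier
    rwa [sub_add_cancel]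
  rw [hR] at hm
  have h1 : y - x + γ ∈ Λ' := hm.1
  rw [← h] at h1 hγ
  have := S.structureGroup.sub_mem (mem_structureGroup_of_mem_pattern h1)
    (mem_structureGroup_of_mem_pattern hγ)
  simpa using this

/-- Every `Λ₀ ∈ 𝕏` is of the form `Λ - t` with `Λ ∈ Ξ^Γ` and `t ∈ ℝ^d`. -/
theorem Hull.exists_eq_vadd [IsTopologicalAddGroup H] (Λ₀ : Hull S W) :
    ∃ p : InternalSystem S W × PhysicalSpace d, Λ₀ = p.2 +ᵥ p.1.toHull := by
  obtain ⟨x, hx⟩ := Λ₀.carrier_nonempty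
  refine ⟨(⟨x +ᵥ Λ₀, fun y hy => ?_⟩, -x), ?_⟩
  · have := Λ₀.sub_mem hx (Hull.mem_vadd.1 hy)
    rwa [add_sub_cancel_right] at this
  · exact (neg_vadd_vadd x Λ₀).symm

/-- The extension `g̃ : 𝕏 → 𝕏` of `g ∈ E(Ξ^Γ, Γ)`: `(Λ - t).g̃ = Λ.g - t` for all `Λ ∈ Ξ^Γ`,
`t ∈ ℝ^d`. The right hand side does not depend on the chosen decomposition, see
`EllisSemigroup.tilde_vadd`. -/
noncomputable def EllisSemigroup.tilde [IsTopologicalAddGroup H]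
    (g : EllisSemigroup S.structureGroup (InternalSystem S W)) (Λ₀ : Hull S W) : Hull S W :=
  Λ₀.exists_eq_vadd.choose.2 +ᵥ (g Λ₀.exists_eq_vadd.choose.1).toHull

theorem EllisSemigroup.tilde_vadd [IsTopologicalAddGroup H]
    (g : EllisSemigroup S.structureGroup (InternalSystem S W)) (Λ : InternalSystem S W)
    (t : PhysicalSpace d) : g.tilde (t +ᵥ Λ.toHull) = t +ᵥ (g Λ).toHull := by
  unfold EllisSemigroup.tilde
  have hp := (t +ᵥ Λ.toHull).exists_eq_vadd.choose_spec
  set p := (t +ᵥ Λ.toHull).exists_eq_vadd.choose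
  have e : Λ.toHull = (p.2 - t) +ᵥ p.1.toHull := by
    rw [sub_eq_neg_add, add_vadd, ← hp, neg_vadd_vadd]
  have hγ : p.2 - t ∈ S.structureGroup := by
    obtain ⟨x, hx⟩ := Λ.toHull.carrier_nonempty
    have h1 := Λ.subset hx
    rw [e] at hx
    have := S.structureGroup.sub_mem (p.1.subset (Hull.mem_vadd.1 hx)) h1
    rwa [add_sub_cancel_left] at this
  have e' : Λ = (⟨p.2 - t, hγ⟩ : S.structureGroup) +ᵥ p.1 := InternalSystem.ext e
  rw [e', EllisSemigroup.map_vadd, InternalSystem.toHull_vadd, ← add_vadd]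
  simp

/-! ### The suspension `E(Ξ^Γ, Γ) ×_Γ ℝ^d` -/

variable (S W)

/-- The congruence on the direct product semigroup `E(Ξ^Γ, Γ) × ℝ^d` given by the elements
`(γ, γ)`, `γ ∈ Γ`, whose first entry stands for the translation `Λ ↦ Λ + γ` of `Ξ^Γ`:
`(g, t)` and `(g', t')` are identified when `g' = g + γ` and `t' = t + γ` for some `γ ∈ Γ`.
(In terms of the action `Λ.γ = Λ - γ`, the translation `Λ ↦ Λ + γ` is the action of `-γ`.) -/
def suspensionCon : Con (EllisSemigroup S.structureGroup (InternalSystem S W) ×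
    Multiplicative (PhysicalSpace d)) where
  r p q := ∃ γ : S.structureGroup,
    q = p * (EllisSemigroup.ofGroup (-γ), Multiplicative.ofAdd (γ : PhysicalSpace d))
  iseqv := by
    refine ⟨fun p => ⟨0, ?_⟩, ?_, ?_⟩
    · refine Prod.ext (EllisSemigroup.ext fun Λ => ?_) ?_
      · exact (by rw [neg_zero, zero_vadd] : p.1 Λ = -(0 : S.structureGroup) +ᵥ p.1 Λ)
      · simp
    · rintro p _ ⟨γ, rfl⟩
      refine ⟨-γ, Prod.ext (EllisSemigroup.ext fun Λ => ?_) ?_⟩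
      · exact (by rw [neg_neg, vadd_neg_vadd] : p.1 Λ = -(-γ) +ᵥ (-γ +ᵥ p.1 Λ))
      · simp
    · rintro p _ _ ⟨γ, rfl⟩ ⟨δ, rfl⟩
      refine ⟨γ + δ, Prod.ext (EllisSemigroup.ext fun Λ => ?_) ?_⟩
      · exact (by rw [← add_vadd, neg_add_rev] : -δ +ᵥ (-γ +ᵥ p.1 Λ) = -(γ + δ) +ᵥ p.1 Λ)
      · simp [mul_assoc]
  mul' := by
    rintro p _ q _ ⟨γ, rfl⟩ ⟨δ, rfl⟩
    refine ⟨γ + δ, Prod.ext (EllisSemigroup.ext fun Λ => ?_) ?_⟩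
    · change -δ +ᵥ q.1 (-γ +ᵥ p.1 Λ) = -(γ + δ) +ᵥ q.1 (p.1 Λ)
      rw [EllisSemigroup.map_vadd, ← add_vadd, neg_add_rev]
    · simp only [Prod.snd_mul, AddSubgroup.coe_add, ofAdd_add]
      exact mul_mul_mul_comm _ _ _ _

/-- The semigroup `E(Ξ^Γ, Γ) ×_Γ ℝ^d`. -/
def SuspensionSemigroup : Type _ := (suspensionCon S W).Quotient

noncomputable instance : Monoid (SuspensionSemigroup S W) :=
  inferInstanceAs (Monoid (suspensionCon S W).Quotient)

/-- The quotient topology. -/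
instance : TopologicalSpace (SuspensionSemigroup S W) :=
  inferInstanceAs (TopologicalSpace (Quotient (suspensionCon S W).toSetoid))

variable {S W}

/-- The class `[g, t]_Γ`. -/
def SuspensionSemigroup.mk (g : EllisSemigroup S.structureGroup (InternalSystem S W))
    (t : PhysicalSpace d) : SuspensionSemigroup S W :=
  Con.toQuotient (c := suspensionCon S W) (g, Multiplicative.ofAdd t)

end CutProject

open Filter Topology

/-! The assignment `(g, t) ↦ g̃ - t` is a jointly continuous homomorphism and descends to the
suspension. It is injective there (`injective_toEllis`) because a translation carrying one non-empty
pattern in `Γ` to another belongs to `Γ`.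

Surjectivity and continuity of the inverse come from compactness, although `Ξ^Γ` itself need not be
compact. By co-compactness of `Σ`, every `t ∈ ℝ^d` is `γ + s` with `s` in a fixed ball and `γ*` in a
fixed compact subset of `H`. Translates of a given `Λ ∈ Ξ^Γ` by such `γ` stay in the pattern of one
compact set, and the members of `Ξ^Γ` with that property form a compact set
(`InternalSystem.isCompact_setOf_subset_pattern`). Tychonoff then puts these `γ` in a compact part
of `E(Ξ^Γ, Γ)` (`exists_isCompact_ellis`). Together with the ball it has a compact image, closed
because the hull is Hausdorff, which contains all translations and hence is `E(𝕏, ℝ^d)`. Injectivity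
now makes the suspension compact, and a continuous bijection from a compact to a Hausdorff space is
a homeomorphism.

The geometric input is uniform repetitivity: it ensures that local limits of hull elements keep the
right language (`exists_patternLanguage_eq`). -/

theorem IsOpenQuotientMap.exists_isCompact_image_eq_univ {X Y : Type*} [TopologicalSpace X]
    [TopologicalSpace Y] [WeaklyLocallyCompactSpace X] [CompactSpace Y] {f : X → Y}
    (hf : IsOpenQuotientMap f) : ∃ D : Set X, IsCompact D ∧ f '' D = Set.univ := by
  choose K hK hKx using fun x : X => exists_compact_mem_nhds x
  choose g hg using hf.surjective
  obtain ⟨F, -, hF⟩ := isCompact_univ.elim_nhds_subcover (fun y => f '' K (g y)) fun y _ => by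
    have := hf.isOpenMap.image_mem_nhds (hKx (g y))
    rwa [hg y] at this
  refine ⟨⋃ y ∈ F, K (g y), F.isCompact_biUnion fun y _ => hK _, ?_⟩
  rw [Set.image_iUnion₂]
  exact Set.univ_subset_iff.1 hF

section

variable {H : Type*} [AddCommGroup H] [TopologicalSpace H] {d : ℕ}

/-! ### Finiteness and covering properties of the lattice -/

namespace CutProjectScheme

theorem mem_translatePattern_pattern (S : CutProjectScheme H d) {A : Set H} {w : H}
    {t x : PhysicalSpace d} : x ∈ translatePattern (S.pattern (w +ᵥ A)) t ↔
      ∃ p ∈ S.lattice, p.1 - w ∈ A ∧ p.2 = x + t := by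
  constructor
  · rintro ⟨p, ⟨hp, hpA, -⟩, e⟩
    refine ⟨p, hp, ?_, e⟩
    rwa [Set.mem_vadd_set_iff_neg_vadd_mem, vadd_eq_add, neg_add_eq_sub] at hpA
  · rintro ⟨p, hp, hpA, e⟩
    refine ⟨p, ⟨hp, ?_, trivial⟩, e⟩
    rwa [Set.mem_vadd_set_iff_neg_vadd_mem, vadd_eq_add, neg_add_eq_sub]

variable [IsTopologicalAddGroup H]

/-- A discrete subgroup of a Hausdorff group is closed, so the intersection is both compact and
discrete. -/
theorem finite_lattice_inter [T2Space H] (S : CutProjectScheme H d) {Q : Set H}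
    {K : Set (PhysicalSpace d)} (hQ : IsCompact Q) (hK : IsCompact K) :
    ((S.lattice : Set (H × PhysicalSpace d)) ∩ Q ×ˢ K).Finite := by
  have := S.discrete
  have hc : IsClosed (S.lattice : Set (H × PhysicalSpace d)) := AddSubgroup.isClosed_of_discrete
  refine ((hQ.prod hK).inter_left hc).finite ?_
  exact (isDiscrete_iff_discreteTopology.2 S.discrete).mono Set.inter_subset_left

/-- Some compact set of `H × ℝ^d` maps onto the compact quotient; `C` and `r` come from its two
projections. -/
theorem exists_isCompact_cover [LocallyCompactSpace H] (S : CutProjectScheme H d) :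
    ∃ C : Set H, IsCompact C ∧ ∃ r : ℝ, ∀ (h : H) (x : PhysicalSpace d),
      ∃ p ∈ S.lattice, h - p.1 ∈ C ∧ ‖x - p.2‖ ≤ r := by
  have := S.cocompact
  obtain ⟨D, hD, hDu⟩ := (QuotientAddGroup.isOpenQuotientMap_mk
    (N := S.lattice)).exists_isCompact_image_eq_univ
  obtain ⟨r, hr⟩ := (hD.image continuous_snd).isBounded.exists_norm_le
  refine ⟨Prod.fst '' D, hD.image continuous_fst, r, fun h x => ?_⟩
  obtain ⟨z, hz, e⟩ : QuotientAddGroup.mk (h, x) ∈ QuotientAddGroup.mk '' D :=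
    hDu ▸ Set.mem_univ ((h, x) : (H × PhysicalSpace d) ⧸ S.lattice)
  refine ⟨-z + (h, x), QuotientAddGroup.eq.1 e, ⟨z, hz, ?_⟩, hr _ ⟨z, hz, ?_⟩⟩ <;> simp

/-- For open non-empty `O ⊆ H`, the pattern of `w + O` is relatively dense, uniformly in `w`. -/
theorem exists_lattice_near [LocallyCompactSpace H] (S : CutProjectScheme H d) {O : Set H}
    (hO : IsOpen O) (hne : O.Nonempty) :
    ∃ r : ℝ, ∀ (w : H) (x : PhysicalSpace d), ∃ p ∈ S.lattice, p.1 - w ∈ O ∧ ‖p.2 - x‖ ≤ r := by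
  obtain ⟨C, hC, r, hr⟩ := S.exists_isCompact_cover
  -- Density of the internal projection moves each `c ∈ C` into `O`, and compactness of `C` needs
  -- only finitely many lattice points `q`. Correcting the approximation `p` by such a `q` costs at
  -- most `M` in physical space.
  obtain ⟨F, hF⟩ := hC.elim_finite_subcover (fun q : S.lattice => {c : H | q.1.1 - c ∈ O})
    (fun q => hO.preimage (continuous_const.sub continuous_id)) fun c _ => by
      obtain ⟨_, hy, q, hq, rfl⟩ := S.dense_fst.inter_open_nonempty {h | h - c ∈ O}
        (hO.preimage (continuous_id.sub continuous_const))
        (hne.imp' (· + c) fun h hh => by simpa using hh)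
      exact Set.mem_iUnion.2 ⟨⟨q, hq⟩, hy⟩
  obtain ⟨M, hM⟩ := (F.image fun q : S.lattice => ‖q.1.2‖).bddAbove
  refine ⟨r + M, fun w x => ?_⟩
  obtain ⟨p, hp, hpC, hpr⟩ := hr w x
  obtain ⟨q, hqF, hq⟩ := Set.mem_iUnion₂.1 (hF hpC)
  refine ⟨q.1 + p, S.lattice.add_mem q.2 hp, ?_, ?_⟩
  · have : (q.1 + p).1 - w = q.1.1 - (w - p.1) := by rw [Prod.fst_add]; abel
    rwa [this]
  · have e : (q.1 + p).2 - x = q.1.2 - (x - p.2) := by rw [Prod.snd_add]; abel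
    rw [e, add_comm r]
    exact (norm_sub_le _ _).trans
      (add_le_add (hM (Finset.mem_coe.2 (Finset.mem_image_of_mem _ hqF))) hpr)

end CutProjectScheme

/-! ### Model sets, repetitivity and local finiteness -/

variable {S : CutProjectScheme H d} {W : Window H}

/-- Differences of points of a pattern in the hull have internal coordinate in `W - W`. -/
theorem Hull.exists_lattice_eq_sub (Λ : Hull S W) {x y : PhysicalSpace d} (hx : x ∈ Λ.carrier)
    (hy : y ∈ Λ.carrier) :
    ∃ p ∈ S.lattice, p.1 ∈ W.carrier - W.carrier ∧ p.2 = y - x := by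
  obtain ⟨Λ', ⟨w, t, -, h⟩, hl⟩ := Λ.language_eq
  have hP : translatePattern Λ.carrier x ∩ Metric.closedBall 0 (‖y - x‖ + 1)
      ∈ patternLanguage Λ' := by
    rw [← hl]; exact ⟨x, hx, _, by positivity, rfl⟩
  obtain ⟨γ, hγ, R, -, hR⟩ := hP
  have hm : y - x ∈ translatePattern Λ.carrier x ∩ Metric.closedBall 0 (‖y - x‖ + 1) :=
    ⟨by simpa [translatePattern] using hy, by simp⟩
  rw [hR] at hm
  have h1 : y - x + γ ∈ Λ' := hm.1
  rw [h, S.mem_translatePattern_pattern] at h1 hγ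
  obtain ⟨p, hp, hpW, ep⟩ := h1
  obtain ⟨q, hq, hqW, eq⟩ := hγ
  refine ⟨p - q, S.lattice.sub_mem hp hq, ⟨_, hpW, _, hqW, by simp⟩, ?_⟩
  rw [Prod.snd_sub, ep, eq]; abel

variable [IsTopologicalAddGroup H]

theorem Window.isCompact_sub (W : Window H) : IsCompact (W.carrier - W.carrier) := by
  rw [← Set.image2_sub, ← Set.image_prod]
  exact (W.isCompact.prod W.isCompact).image continuous_sub

/-- Baire category: the boundary of the closed set `W` is nowhere dense and `Σ` is countable, so a
generic `w` avoids all the translates that make `w + W` singular. -/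
theorem exists_isNonSingularModelSet [LocallyCompactSpace H] [T2Space H]
    (S : CutProjectScheme H d) (W : Window H) : ∃ Λ, IsNonSingularModelSet S W Λ := by
  have := S.countable
  have hc : IsClosed W.carrier := W.isCompact.isClosed
  have hd : Dense (⋂ p : S.lattice, {w : H | p.1.1 - w ∉ frontier W.carrier}) := by
    refine dense_iInter_of_isOpen (fun p => ?_) fun p => ?_
    · exact isClosed_frontier.isOpen_compl.preimage (continuous_const.sub continuous_id)
    · have : Dense (frontier W.carrier)ᶜ := interior_eq_empty_iff_dense_compl.1
        (interior_frontier hc)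
      exact this.preimage (Homeomorph.subLeft p.1.1).isOpenMap
  obtain ⟨w, hw⟩ := hd.nonempty
  refine ⟨_, w, 0, rfl, ?_⟩
  ext x
  simp only [S.mem_translatePattern_pattern]
  refine exists_congr fun p => and_congr_right fun hp => and_congr_left fun _ =>
    ⟨fun h => interior_subset h, fun h => ?_⟩
  by_contra h'
  exact Set.mem_iInter.1 hw ⟨p, hp⟩ ⟨subset_closure h, h'⟩

/-- Repetitivity: a patch of a non-singular model set occurs in all non-singular model sets at all
points whose internal coordinate lies in some translate of a fixed open set. -/
theorem IsNonSingularModelSet.exists_isOpen_patch [T2Space H] {Λ : Set (PhysicalSpace d)}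
    (hΛ : IsNonSingularModelSet S W Λ) {γ : PhysicalSpace d} (hγ : γ ∈ Λ) (R : ℝ) :
    ∃ O : Set H, IsOpen O ∧ O.Nonempty ∧ ∀ Λ', IsNonSingularModelSet S W Λ' →
      ∃ (w : H) (t : PhysicalSpace d), ∀ p ∈ S.lattice, p.1 - w ∈ O → p.2 - t ∈ Λ' ∧
        translatePattern Λ' (p.2 - t) ∩ Metric.closedBall 0 R =
          translatePattern Λ γ ∩ Metric.closedBall 0 R := by
  obtain ⟨w₁, t₁, hi, hc⟩ := hΛ
  have mem_c : ∀ x, x ∈ Λ ↔ ∃ p ∈ S.lattice, p.1 - w₁ ∈ W.carrier ∧ p.2 = x + t₁ := fun x => by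
    rw [← S.mem_translatePattern_pattern, ← hc]
  have mem_i : ∀ x, x ∈ Λ ↔ ∃ p ∈ S.lattice, p.1 - w₁ ∈ interior W.carrier ∧ p.2 = x + t₁ :=
    fun x => by rw [← S.mem_translatePattern_pattern, hi]
  obtain ⟨p₁, hp₁, hp₁W, e₁⟩ := (mem_i γ).1 hγ
  have hF := S.finite_lattice_inter (W.isCompact_sub)
    (isCompact_closedBall (0 : PhysicalSpace d) R)
  set F := (S.lattice : Set (H × PhysicalSpace d)) ∩
    (W.carrier - W.carrier) ×ˢ Metric.closedBall 0 R
  -- Only the finitely many differences in `F` can occur within distance `R`. Each imposes an open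
  -- condition: a site present lands in the interior of `W`, an absent one outside the closed set
  -- `W`. Non-singularity of `Λ` makes `γ` itself satisfy all of them.
  let O : Set H := interior W.carrier ∩ ⋂ q ∈ F,
    {h | (q.2 + γ ∈ Λ → h + q.1 ∈ interior W.carrier) ∧ (q.2 + γ ∉ Λ → h + q.1 ∉ W.carrier)}
  refine ⟨O, ?_, ⟨p₁.1 - w₁, hp₁W, ?_⟩, ?_⟩
  · refine isOpen_interior.inter (hF.isOpen_biInter fun q _ => ?_)
    by_cases hq : q.2 + γ ∈ Λ
    · simpa only [hq, true_imp_iff, not_true, false_imp_iff, and_true] using!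
        isOpen_interior.preimage (continuous_add_const q.1)
    · simpa only [hq, true_imp_iff, not_false_iff, false_imp_iff, true_and] using!
        W.isCompact.isClosed.isOpen_compl.preimage (continuous_add_const q.1)
  · refine Set.mem_iInter₂.2 fun q hq => ⟨fun h => ?_, fun h h' => h ?_⟩
    · obtain ⟨p, hp, hpW, e⟩ := (mem_i _).1 h
      have : p = p₁ + q := S.injOn_snd hp (S.lattice.add_mem hp₁ hq.1) (by
        rw [e, Prod.snd_add, e₁]; abel)
      rw [this, Prod.fst_add] at hpW
      rwa [sub_add_eq_add_sub]
    · refine (mem_c _).2 ⟨p₁ + q, S.lattice.add_mem hp₁ hq.1, ?_, ?_⟩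
      · rwa [Prod.fst_add, ← sub_add_eq_add_sub]
      · rw [Prod.snd_add, e₁]; abel
  · rintro Λ' ⟨w, t, hi', hc'⟩
    refine ⟨w, t, fun p hp hpO => ⟨?_, ?_⟩⟩
    · rw [← hi', S.mem_translatePattern_pattern]
      exact ⟨p, hp, hpO.1, by abel⟩
    · ext y
      refine and_congr_left fun hy => ?_
      change y + (p.2 - t) ∈ Λ' ↔ y + γ ∈ Λ
      constructor
      · intro h
        rw [hc', S.mem_translatePattern_pattern] at h
        obtain ⟨p', hp', hW', e'⟩ := h
        have ey : (p' - p).2 = y := by rw [Prod.snd_sub, e']; abel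
        have hq : p' - p ∈ F := by
          refine ⟨S.lattice.sub_mem hp' hp, ⟨p'.1 - w, hW', p.1 - w, interior_subset hpO.1, ?_⟩, ?_⟩
          · simp
          · rwa [ey]
        by_contra hn
        refine (Set.mem_iInter₂.1 hpO.2 _ hq).2 (by rwa [ey]) ?_
        have : p.1 - w + (p' - p).1 = p'.1 - w := by rw [Prod.fst_sub]; abel
        rwa [this]
      · intro h
        obtain ⟨p', hp', hW', e'⟩ := (mem_c _).1 h
        have ey : (p' - p₁).2 = y := by rw [Prod.snd_sub, e', e₁]; abel
        have hq : p' - p₁ ∈ F := by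
          refine ⟨S.lattice.sub_mem hp' hp₁,
            ⟨p'.1 - w₁, hW', p₁.1 - w₁, interior_subset hp₁W, ?_⟩, ?_⟩
          · simp
          · rwa [ey]
        rw [← hi', S.mem_translatePattern_pattern]
        refine ⟨p + (p' - p₁), S.lattice.add_mem hp hq.1, ?_, ?_⟩
        · have := (Set.mem_iInter₂.1 hpO.2 _ hq).1 (by rwa [ey])
          rwa [Prod.fst_add, ← sub_add_eq_add_sub]
        · rw [Prod.snd_add, ey]; abel

/-- Repetitivity is uniform among non-singular model sets. -/
theorem IsNonSingularModelSet.exists_patch_near [LocallyCompactSpace H] [T2Space H]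
    {Λ : Set (PhysicalSpace d)} (hΛ : IsNonSingularModelSet S W Λ) {γ : PhysicalSpace d}
    (hγ : γ ∈ Λ) (R : ℝ) :
    ∃ r : ℝ, ∀ Λ', IsNonSingularModelSet S W Λ' → ∀ x, ∃ γ' ∈ Λ', ‖γ' - x‖ ≤ r ∧
        translatePattern Λ' γ' ∩ Metric.closedBall 0 R =
          translatePattern Λ γ ∩ Metric.closedBall 0 R := by
  obtain ⟨O, hO, hne, h⟩ := hΛ.exists_isOpen_patch hγ R
  obtain ⟨r, hr⟩ := S.exists_lattice_near hO hne
  refine ⟨r, fun Λ' hΛ' x => ?_⟩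
  obtain ⟨w, t, hwt⟩ := h Λ' hΛ'
  obtain ⟨p, hp, hpO, hpr⟩ := hr w (x + t)
  exact ⟨p.2 - t, (hwt p hp hpO).1, by rwa [sub_sub, add_comm t], (hwt p hp hpO).2⟩

/-- A hull element as the hull element of a non-singular model set. -/
def IsNonSingularModelSet.toHull {Λ : Set (PhysicalSpace d)} (hΛ : IsNonSingularModelSet S W Λ) :
    Hull S W := ⟨Λ, Λ, hΛ, rfl⟩

theorem IsNonSingularModelSet.nonempty {Λ : Set (PhysicalSpace d)}
    (hΛ : IsNonSingularModelSet S W Λ) : Λ.Nonempty := hΛ.toHull.carrier_nonempty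

/-- Patches of an element of the hull are patches of the same radius of a model set. -/
theorem Hull.exists_patch_eq [LocallyCompactSpace H] [T2Space H] (Λ : Hull S W)
    {Λ' : Set (PhysicalSpace d)} (hΛ' : IsNonSingularModelSet S W Λ')
    (hl : patternLanguage Λ.carrier = patternLanguage Λ') {γ : PhysicalSpace d}
    (hγ : γ ∈ Λ.carrier) {R : ℝ} (hR : 0 < R) :
    ∃ γ' ∈ Λ', translatePattern Λ.carrier γ ∩ Metric.closedBall 0 R =
      translatePattern Λ' γ' ∩ Metric.closedBall 0 R := by
  have key : ∀ R' : ℝ, 0 < R' → ∃ γ' ∈ Λ', ∃ r : ℝ, 0 < r ∧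
      translatePattern Λ.carrier γ ∩ Metric.closedBall 0 R' =
      translatePattern Λ' γ' ∩ Metric.closedBall 0 r := fun R' hR' => by
    have : translatePattern Λ.carrier γ ∩ Metric.closedBall 0 R' ∈ patternLanguage Λ.carrier :=
      ⟨γ, hγ, R', hR', rfl⟩
    rwa [hl] at this
  -- Equality of languages does not match radii. If a match with both radii at least `R` exists,
  -- truncate it to radius `R`. Otherwise `Λ`, hence `Λ'`, is bounded; relative density of `Λ'` then
  -- bounds `ℝ^d`, so `d = 0`, where radii do not matter.
  by_cases hb : ∃ R' ≥ R, ∃ γ' ∈ Λ', ∃ r ≥ R,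
      translatePattern Λ.carrier γ ∩ Metric.closedBall 0 R' =
      translatePattern Λ' γ' ∩ Metric.closedBall 0 r
  · obtain ⟨R', hR', γ', hγ', r, hr, e⟩ := hb
    refine ⟨γ', hγ', ?_⟩
    have h1 := Metric.closedBall_subset_closedBall (x := (0 : PhysicalSpace d)) hR'
    have h2 := Metric.closedBall_subset_closedBall (x := (0 : PhysicalSpace d)) hr
    rw [← Set.inter_eq_self_of_subset_right h1, ← Set.inter_assoc, e, Set.inter_assoc,
      Set.inter_eq_self_of_subset_right h1, Set.inter_eq_self_of_subset_right h2]
  · push Not at hb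
    have hΛb : ∀ x ∈ Λ.carrier, ‖x - γ‖ ≤ R := by
      intro x hx
      obtain ⟨γ', hγ', r, -, e⟩ := key (max R ‖x - γ‖) (lt_max_of_lt_left hR)
      have hr : r < R := by
        by_contra! hr
        exact hb _ (le_max_left _ _) γ' hγ' r hr e
      have hx' : x - γ ∈ translatePattern Λ.carrier γ ∩ Metric.closedBall 0 (max R ‖x - γ‖) :=
        ⟨by simpa [translatePattern] using hx, by simp⟩
      rw [e] at hx'
      exact (mem_closedBall_zero_iff.1 hx'.2).trans hr.le
    obtain ⟨γ₁, hγ₁⟩ := hΛ'.nonempty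
    have hΛb' : ∀ y ∈ Λ', ‖y - γ₁‖ ≤ 2 * R := by
      intro y hy
      have hP : translatePattern Λ' γ₁ ∩ Metric.closedBall 0 (‖y - γ₁‖ + 1)
          ∈ patternLanguage Λ.carrier := by
        rw [hl]; exact ⟨γ₁, hγ₁, _, by positivity, rfl⟩
      obtain ⟨δ, hδ, r, -, e⟩ := hP
      have hy' : y - γ₁ ∈ translatePattern Λ' γ₁ ∩ Metric.closedBall 0 (‖y - γ₁‖ + 1) :=
        ⟨by simpa [translatePattern] using hy, by simp⟩
      rw [e] at hy'
      have h1 := hΛb _ hy'.1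
      have h2 := hΛb _ hδ
      have : y - γ₁ = (y - γ₁ + δ - γ) - (δ - γ) := by abel
      rw [this, two_mul]
      exact (norm_sub_le _ _).trans (add_le_add h1 h2)
    obtain ⟨r, hr⟩ := hΛ'.exists_patch_near hγ₁ R
    have hbd : ∀ x : PhysicalSpace d, ‖x‖ ≤ r + 2 * R := by
      intro x
      obtain ⟨y, hy, hyx, -⟩ := hr Λ' hΛ' (x + γ₁)
      have : x = (y - γ₁) - (y - (x + γ₁)) := by abel
      rw [this, add_comm r]
      exact (norm_sub_le _ _).trans (add_le_add (hΛb' y hy) hyx)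
    have hz : ∀ x : PhysicalSpace d, x = 0 := by
      intro x
      by_contra hx
      have : Nontrivial (PhysicalSpace d) := ⟨x, 0, hx⟩
      obtain ⟨y, hy⟩ := NormedSpace.exists_lt_norm ℝ (PhysicalSpace d) (r + 2 * R)
      exact (hbd y).not_gt hy
    obtain ⟨γ', hγ', ρ, hρ, e⟩ := key R hR
    have hu : ∀ s : ℝ, 0 < s → Metric.closedBall (0 : PhysicalSpace d) s = Set.univ :=
      fun s hs => Set.eq_univ_of_forall fun x => by simp [hz x, hs.le]
    exact ⟨γ', hγ', by rw [e, hu _ hR, hu _ hρ]⟩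

/-- Repetitivity is uniform on the hull. -/
theorem IsNonSingularModelSet.exists_hull_patch_near [LocallyCompactSpace H] [T2Space H]
    {Λ : Set (PhysicalSpace d)} (hΛ : IsNonSingularModelSet S W Λ) {γ : PhysicalSpace d}
    (hγ : γ ∈ Λ) {R : ℝ} (hR : 0 < R) :
    ∃ r : ℝ, ∀ (Λ' : Hull S W) (x : PhysicalSpace d), ∃ γ' ∈ Λ'.carrier, ‖γ' - x‖ ≤ r ∧
        translatePattern Λ'.carrier γ' ∩ Metric.closedBall 0 R =
          translatePattern Λ γ ∩ Metric.closedBall 0 R := by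
  obtain ⟨r, hr⟩ := hΛ.exists_patch_near hγ R
  refine ⟨r, fun Λ' x => ?_⟩
  obtain ⟨Λ₁, hΛ₁, hl⟩ := Λ'.language_eq
  obtain ⟨γ₀, hγ₀⟩ := Λ'.carrier_nonempty
  have hr0 : 0 ≤ r := (norm_nonneg _).trans (hr Λ hΛ x).choose_spec.2.1
  -- The occurrence `γ₂` below lies within `‖x - γ₀‖ + r` of `γ₁`; the extra `R` keeps its whole
  -- patch in the region copied from `Λ₁`.
  obtain ⟨γ₁, hγ₁, e⟩ := Λ'.exists_patch_eq hΛ₁ hl hγ₀ (R := ‖x - γ₀‖ + r + R) (by positivity)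
  obtain ⟨γ₂, hγ₂, hγ₂r, e₂⟩ := hr Λ₁ hΛ₁ (x - γ₀ + γ₁)
  have hn : ‖γ₂ - γ₁‖ ≤ ‖x - γ₀‖ + r := by
    have : γ₂ - γ₁ = (x - γ₀) + (γ₂ - (x - γ₀ + γ₁)) := by abel
    rw [this]
    exact (norm_add_le _ _).trans (add_le_add_right hγ₂r _)
  have hag : ∀ y : PhysicalSpace d, ‖y‖ ≤ R →
      (y + (γ₂ - γ₁ + γ₀) ∈ Λ'.carrier ↔ y + γ₂ ∈ Λ₁) := by
    intro y hy
    have hm : y + (γ₂ - γ₁) ∈ Metric.closedBall (0 : PhysicalSpace d) (‖x - γ₀‖ + r + R) := by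
      rw [mem_closedBall_zero_iff, add_comm _ R]
      exact (norm_add_le _ _).trans (add_le_add hy hn)
    have := Set.ext_iff.1 e (y + (γ₂ - γ₁))
    simp only [Set.mem_inter_iff, hm, and_true, translatePattern, Set.mem_ofPred_eq] at this
    rw [← add_assoc, this]
    simp [add_assoc]
  refine ⟨γ₂ - γ₁ + γ₀, ?_, ?_, ?_⟩
  · simpa using (hag 0 (by simpa using hR.le)).2 (by simpa using hγ₂)
  · have : γ₂ - γ₁ + γ₀ - x = γ₂ - (x - γ₀ + γ₁) := by abel
    rwa [this]
  · rw [← e₂]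
    ext y
    exact and_congr_left fun hy => hag y (mem_closedBall_zero_iff.1 hy)

/-- The elements of the hull are locally finite. -/
theorem Hull.finite_inter [T2Space H] (Λ : Hull S W) {K : Set (PhysicalSpace d)}
    (hK : IsCompact K) : (Λ.carrier ∩ K).Finite := by
  obtain ⟨γ, hγ⟩ := Λ.carrier_nonempty
  refine ((S.finite_lattice_inter (W.isCompact_sub)
    (isCompact_translatePattern hK γ)).image fun p => p.2 + γ).subset ?_
  rintro x ⟨hx, hxK⟩
  obtain ⟨p, hp, hpW, e⟩ := Λ.exists_lattice_eq_sub hγ hx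
  refine ⟨p, ⟨hp, hpW, ?_⟩, ?_⟩
  · change p.2 + γ ∈ K
    rwa [e, sub_add_cancel]
  · simp [e]

end

/-! ### General facts on Ellis semigroups -/

theorem EllisSemigroup.isClosedEmbedding_coe {T X : Type*} [AddGroup T] [AddAction T X]
    [TopologicalSpace X] : IsClosedEmbedding fun (g : EllisSemigroup T X) (x : X) => g x :=
  IsClosed.isClosedEmbedding_subtypeVal isClosed_closure

theorem EllisSemigroup.denseRange_ofGroup {T X : Type*} [AddGroup T] [AddAction T X]
    [TopologicalSpace X] : DenseRange (ofGroup : T → EllisSemigroup T X) := by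
  intro g
  rw [isClosedEmbedding_coe.isInducing.closure_eq_preimage_closure_image, ← Set.range_comp]
  exact g.2

instance EllisSemigroup.instT2Space {T X : Type*} [AddGroup T] [AddAction T X]
    [TopologicalSpace X] [T2Space X] : T2Space (EllisSemigroup T X) :=
  isClosedEmbedding_coe.isEmbedding.t2Space

section

variable {H : Type*} [AddCommGroup H] [TopologicalSpace H] {d : ℕ}
  {S : CutProjectScheme H d} {W : Window H}

/-! ### Topology of the hull -/

theorem Hull.mem_basicNhd_self (Λ : Hull S W) (K : Set (PhysicalSpace d)) {ε : ℝ} (hε : 0 < ε) :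
    Λ ∈ Λ.basicNhd K ε :=
  ⟨0, 0, by simpa, by simpa, rfl⟩

theorem Hull.isOpen_basicNhd (Λ : Hull S W) {K : Set (PhysicalSpace d)} (hK : IsCompact K)
    (ε : ℝ) : IsOpen (Λ.basicNhd K ε) := by
  rintro Λ' ⟨t, t', ht, ht', e⟩
  -- The slack `ε - ‖t'‖` is split between the two new shifts `s, s'`. Enlarging `K` by a ball of
  -- radius `2 * ε` absorbs the displacement `t' - s`.
  refine ⟨(fun p : PhysicalSpace d × PhysicalSpace d => p.1 + p.2) ''
    K ×ˢ Metric.closedBall 0 (2 * ε), (hK.prod (isCompact_closedBall _ _)).image continuous_add,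
    (ε - ‖t'‖) / 2, by linarith, ?_⟩
  rintro Λ'' ⟨s, s', hs, hs', e'⟩
  refine ⟨t, t' + s' - s, ht, ?_, ?_⟩
  · rw [add_sub_assoc]
    have := norm_add_le t' (s' - s)
    have := norm_sub_le s' s
    linarith
  · rw [e]
    ext x
    refine and_congr_left fun hx => ?_
    have hm : x + (t' - s) ∈ (fun p : PhysicalSpace d × PhysicalSpace d => p.1 + p.2) ''
        K ×ˢ Metric.closedBall 0 (2 * ε) := by
      refine ⟨(x, t' - s), ⟨hx, ?_⟩, rfl⟩
      rw [mem_closedBall_zero_iff]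
      have := norm_sub_le t' s
      have := norm_nonneg t'
      linarith
    have := Set.ext_iff.1 e' (x + (t' - s))
    simp only [Set.mem_inter_iff, hm, and_true, translatePattern, Set.mem_ofPred_eq] at this
    have h1 : x + (t' - s) + s = x + t' := by abel
    have h2 : x + (t' - s) + s' = x + (t' + s' - s) := by abel
    rwa [h1, h2] at this

theorem Hull.basicNhd_mem_nhds (Λ : Hull S W) {K : Set (PhysicalSpace d)} (hK : IsCompact K)
    {ε : ℝ} (hε : 0 < ε) : Λ.basicNhd K ε ∈ 𝓝 Λ :=
  (Λ.isOpen_basicNhd hK ε).mem_nhds (Λ.mem_basicNhd_self K hε)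

instance Hull.instContinuousVAdd : ContinuousVAdd (PhysicalSpace d) (Hull S W) where
  continuous_vadd := by
    refine continuous_iff_continuousAt.2 fun ⟨t, Λ⟩ U hU => ?_
    obtain ⟨V, hVU, hV, hm⟩ := mem_nhds_iff.1 hU
    obtain ⟨K, hK, ε, hε, h⟩ := hV _ hm
    have hb := prod_mem_nhds (Metric.ball_mem_nhds t (half_pos hε))
      (Λ.basicNhd_mem_nhds (isCompact_translatePattern hK (-t)) (half_pos hε))
    refine mem_map.2 (mem_of_superset hb ?_)
    rintro ⟨t', Λ'⟩ ⟨ht', s, s', hs, hs', e⟩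
    -- The change from `t` to `t'` is absorbed into the small shift of `Λ'`, whence the two halves
    -- of `ε`.
    refine hVU (h ⟨s, s' + t - t', by linarith, ?_, ?_⟩)
    · rw [Metric.mem_ball, dist_comm, dist_eq_norm] at ht'
      have := norm_add_le s' (t - t')
      rw [add_sub_assoc]
      linarith
    · ext x
      have := Set.ext_iff.1 e (x + t)
      have h1 : x + t + s = x + s + t := by abel
      have h2 : x + t + s' = x + (s' + t - t') + t' := by abel
      simpa only [Set.mem_inter_iff, translatePattern, Set.mem_ofPred_eq, Hull.mem_vadd,
        add_neg_cancel_right, h1, h2] using this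

theorem InternalSystem.continuous_toHull :
    Continuous (InternalSystem.toHull : InternalSystem S W → Hull S W) := by
  refine ⟨fun U hU Λ hΛ => ?_⟩
  obtain ⟨K, hK, ε, hε, h⟩ := hU _ hΛ
  refine ⟨K, hK, fun Λ' e => h ⟨0, 0, by simpa, by simpa, ?_⟩⟩
  simpa [translatePattern] using! e

/-! ### The isomorphism -/

namespace SuspensionSemigroup

theorem exists_mk_eq (a : SuspensionSemigroup S W) : ∃ g t, mk g t = a := by
  obtain ⟨p, rfl⟩ := Quotient.exists_rep a
  exact ⟨p.1, p.2.toAdd, rfl⟩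

theorem continuous_mk : Continuous fun p : EllisSemigroup S.structureGroup
    (InternalSystem S W) × PhysicalSpace d => mk p.1 p.2 :=
  continuous_quotient_mk'.comp
    (continuous_fst.prodMk (continuous_ofAdd.comp continuous_snd))

end SuspensionSemigroup

variable [IsTopologicalAddGroup H]

namespace EllisSemigroup

theorem tilde_ofGroup (γ : S.structureGroup) (Λ : Hull S W) :
    (ofGroup γ : EllisSemigroup S.structureGroup (InternalSystem S W)).tilde Λ =
      (γ : PhysicalSpace d) +ᵥ Λ := by
  obtain ⟨⟨Λ, t⟩, rfl⟩ := Λ.exists_eq_vadd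
  rw [tilde_vadd, vadd_comm]
  rfl

/-- At a point `Λ - t` the map is evaluation at `Λ`, then inclusion into the hull, then a
translation. -/
theorem continuous_tilde : Continuous fun (g : EllisSemigroup S.structureGroup
    (InternalSystem S W)) (Λ : Hull S W) => g.tilde Λ := by
  refine continuous_pi fun Λ => ?_
  obtain ⟨⟨Λ, t⟩, rfl⟩ := Λ.exists_eq_vadd
  simp only [tilde_vadd]
  exact (InternalSystem.continuous_toHull.comp
    ((continuous_apply Λ).comp isClosedEmbedding_coe.continuous)).const_vadd t

theorem tilde_mem (g : EllisSemigroup S.structureGroup (InternalSystem S W)) :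
    g.tilde ∈ ellisSet (PhysicalSpace d) (Hull S W) := by
  refine map_mem_closure continuous_tilde (denseRange_ofGroup g) ?_
  rintro _ ⟨γ, rfl⟩
  exact ⟨γ, funext fun Λ => (tilde_ofGroup γ Λ).symm⟩

/-- The transformation `g̃ - t` of the hull. -/
noncomputable def tildeSub (g : EllisSemigroup S.structureGroup (InternalSystem S W))
    (t : PhysicalSpace d) : EllisSemigroup (PhysicalSpace d) (Hull S W) :=
  ⟨fun Λ => t +ᵥ g.tilde Λ, comp_mem (tilde_mem g) (ofGroup t).2⟩

theorem tildeSub_apply (g : EllisSemigroup S.structureGroup (InternalSystem S W))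
    (t : PhysicalSpace d) (Λ : Hull S W) : tildeSub g t Λ = t +ᵥ g.tilde Λ := rfl

theorem tildeSub_vadd (g : EllisSemigroup S.structureGroup (InternalSystem S W))
    (t s : PhysicalSpace d) (Λ : InternalSystem S W) :
    tildeSub g t (s +ᵥ Λ.toHull) = (t + s) +ᵥ (g Λ).toHull := by
  rw [tildeSub_apply, tilde_vadd, add_vadd]

theorem ext_vadd_toHull {f f' : EllisSemigroup (PhysicalSpace d) (Hull S W)}
    (h : ∀ (s : PhysicalSpace d) (Λ : InternalSystem S W),
      f (s +ᵥ Λ.toHull) = f' (s +ᵥ Λ.toHull)) : f = f' := by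
  refine EllisSemigroup.ext fun Λ => ?_
  obtain ⟨⟨Λ, t⟩, rfl⟩ := Λ.exists_eq_vadd
  exact h t Λ

theorem tildeSub_mul (g g' : EllisSemigroup S.structureGroup (InternalSystem S W))
    (t t' : PhysicalSpace d) : tildeSub (g * g') (t + t') = tildeSub g t * tildeSub g' t' := by
  refine ext_vadd_toHull fun s Λ => ?_
  rw [mul_apply, tildeSub_vadd, tildeSub_vadd, tildeSub_vadd, mul_apply, add_left_comm, add_assoc]

/-- All translations of `ℝ^d` are thus attained, and the choice of `γ` is free: this lets `t` be
kept bounded in the compactness argument. -/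
theorem tildeSub_ofGroup (γ : S.structureGroup) (t : PhysicalSpace d) :
    tildeSub (ofGroup γ : EllisSemigroup S.structureGroup (InternalSystem S W)) t =
      ofGroup (t + γ) := by
  refine EllisSemigroup.ext fun Λ => ?_
  rw [tildeSub_apply, tilde_ofGroup, ← add_vadd]
  rfl

theorem continuous_tildeSub : Continuous fun p : EllisSemigroup S.structureGroup
    (InternalSystem S W) × PhysicalSpace d => tildeSub p.1 p.2 := by
  refine isClosedEmbedding_coe.isInducing.continuous_iff.2 (continuous_pi fun Λ => ?_)
  exact continuous_snd.vadd ((continuous_apply Λ).comp (continuous_tilde.comp continuous_fst))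

end EllisSemigroup

namespace SuspensionSemigroup

variable (S W)

/-- The homomorphism `[g, t]_Γ ↦ g̃ - t`. -/
noncomputable def toEllis : SuspensionSemigroup S W →* EllisSemigroup (PhysicalSpace d) (Hull S W) :=
  (suspensionCon S W).lift
    { toFun := fun p => EllisSemigroup.tildeSub p.1 p.2.toAdd
      map_one' := by
        refine EllisSemigroup.ext_vadd_toHull fun s Λ => ?_
        exact (EllisSemigroup.tildeSub_vadd 1 0 s Λ).trans (by rw [zero_add]; rfl)
      map_mul' := fun p q => EllisSemigroup.tildeSub_mul _ _ _ _ } (by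
    rintro p _ ⟨γ, rfl⟩
    refine EllisSemigroup.ext_vadd_toHull fun s Λ => ?_
    refine (EllisSemigroup.tildeSub_vadd p.1 p.2.toAdd s Λ).trans
      (Eq.trans ?_ (EllisSemigroup.tildeSub_vadd _ (p.2.toAdd + (γ : PhysicalSpace d)) s Λ).symm)
    -- The shift by `-γ` in the first entry cancels the shift by `γ` in the second.
    change _ = _ +ᵥ (-(γ : PhysicalSpace d) +ᵥ (p.1 Λ).toHull)
    rw [← add_vadd]
    congr 1
    abel)

variable {S W}
theorem toEllis_mk (g : EllisSemigroup S.structureGroup (InternalSystem S W))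
    (t : PhysicalSpace d) : toEllis S W (mk g t) = EllisSemigroup.tildeSub g t := rfl

theorem continuous_toEllis : Continuous (toEllis S W) :=
  Continuous.quotient_lift (EllisSemigroup.continuous_tildeSub.comp
    (continuous_fst.prodMk (continuous_toAdd.comp continuous_snd))) _

end SuspensionSemigroup

/-! ### Compactness -/

variable [T2Space H]

theorem Hull.isClosed_carrier (Λ : Hull S W) : IsClosed Λ.carrier := by
  refine (CompactlyCoherentSpace.isClosed_iff _).2 fun K hK => ?_
  simpa [Set.preimage_inter] using
    (Λ.finite_inter hK).isClosed.preimage (continuous_subtype_val (p := (· ∈ K)))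

/-- A common member `M` would carry `x` to a point of `M` and on to a point of the closed set `Λ'`,
using four shifts shorter than `δ / 4`; but `Λ'` misses the `δ`-ball around `x`. -/
theorem Hull.exists_disjoint_basicNhd (Λ Λ' : Hull S W) {x : PhysicalSpace d}
    (hx : x ∈ Λ.carrier) (hx' : x ∉ Λ'.carrier) : ∃ K : Set (PhysicalSpace d), IsCompact K ∧
      ∃ ε : ℝ, 0 < ε ∧ Disjoint (Λ.basicNhd K ε) (Λ'.basicNhd K ε) := by
  obtain ⟨δ, hδ, hb⟩ := Metric.isOpen_iff.1 Λ'.isClosed_carrier.isOpen_compl x hx'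
  refine ⟨Metric.closedBall 0 (‖x‖ + δ), isCompact_closedBall _ _, δ / 4, by positivity, ?_⟩
  rw [Set.disjoint_left]
  rintro M ⟨t, s, ht, hs, e⟩ ⟨t', s', ht', hs', e'⟩
  have e1 := Set.ext_iff.1 e (x - t)
  have e2 := Set.ext_iff.1 e' (x - t + s - s')
  have n1 := norm_sub_le x t
  have n2 := norm_add_le (x - t) s
  have n3 := norm_sub_le (x - t + s) s'
  simp only [Set.mem_inter_iff, translatePattern, Set.mem_ofPred_eq, sub_add_cancel,
    mem_closedBall_zero_iff] at e1 e2
  have h1 := (e1.1 ⟨hx, by linarith⟩).1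
  have h2 := (e2.2 ⟨h1, by linarith⟩).1
  refine hb (Metric.mem_ball.2 ?_) h2
  have : x - t + s - s' + t' - x = (s - t) + (t' - s') := by abel
  rw [dist_eq_norm, this]
  have n4 := norm_add_le (s - t) (t' - s')
  have n5 := norm_sub_le s t
  have n6 := norm_sub_le t' s'
  linarith

instance Hull.instT2Space : T2Space (Hull S W) where
  t2 Λ Λ' hne := by
    obtain ⟨x, hx⟩ : ∃ x, ¬ (x ∈ Λ.carrier ↔ x ∈ Λ'.carrier) := by
      by_contra! h
      exact hne (Hull.ext (Set.ext h))
    by_cases hx1 : x ∈ Λ.carrier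
    · obtain ⟨K, hK, ε, hε, hd⟩ := Λ.exists_disjoint_basicNhd Λ' hx1 fun h => hx (by simp [hx1, h])
      exact ⟨_, _, Λ.isOpen_basicNhd hK ε, Λ'.isOpen_basicNhd hK ε, Λ.mem_basicNhd_self K hε,
        Λ'.mem_basicNhd_self K hε, hd⟩
    · have hx2 : x ∈ Λ'.carrier := by
        by_contra h
        exact hx (by simp [hx1, h])
      obtain ⟨K, hK, ε, hε, hd⟩ := Λ'.exists_disjoint_basicNhd Λ hx2 hx1
      exact ⟨_, _, Λ.isOpen_basicNhd hK ε, Λ'.isOpen_basicNhd hK ε, Λ.mem_basicNhd_self K hε,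
        Λ'.mem_basicNhd_self K hε, hd.symm⟩

variable [LocallyCompactSpace H]

/-- A point pattern which agrees on every ball with an element of the hull lies in the hull. -/
theorem exists_patternLanguage_eq {Λ : Set (PhysicalSpace d)}
    (h : ∀ R : ℝ, ∃ M : Hull S W, M.carrier ∩ Metric.closedBall 0 R = Λ ∩ Metric.closedBall 0 R) :
    ∃ Λ' : Set (PhysicalSpace d), IsNonSingularModelSet S W Λ' ∧
      patternLanguage Λ = patternLanguage Λ' := by
  have hagree : ∀ (M : Hull S W) (γ : PhysicalSpace d) (R R' : ℝ), ‖γ‖ + R ≤ R' →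
      M.carrier ∩ Metric.closedBall 0 R' = Λ ∩ Metric.closedBall 0 R' →
      translatePattern M.carrier γ ∩ Metric.closedBall 0 R =
        translatePattern Λ γ ∩ Metric.closedBall 0 R := by
    intro M γ R R' hR e
    ext y
    refine and_congr_left fun hy => ?_
    have hm : y + γ ∈ Metric.closedBall (0 : PhysicalSpace d) R' := by
      rw [mem_closedBall_zero_iff] at hy ⊢
      have := norm_add_le y γ
      linarith
    simpa [Set.mem_inter_iff, hm] using! Set.ext_iff.1 e (y + γ)
  obtain ⟨Λ', hΛ'⟩ := exists_isNonSingularModelSet S W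
  refine ⟨Λ', hΛ', Set.Subset.antisymm ?_ ?_⟩
  · rintro _ ⟨γ, hγ, R, hR, rfl⟩
    obtain ⟨M, hM⟩ := h (‖γ‖ + R)
    have hγM : γ ∈ M.carrier := by
      have := (Set.ext_iff.1 hM γ).2 ⟨hγ, by simpa using hR.le⟩
      exact this.1
    obtain ⟨Λ₁, hΛ₁, hl⟩ := M.language_eq
    obtain ⟨γ₁, hγ₁, e₁⟩ := M.exists_patch_eq hΛ₁ hl hγM hR
    obtain ⟨r, hr⟩ := hΛ₁.exists_patch_near hγ₁ R
    obtain ⟨γ', hγ', -, e'⟩ := hr Λ' hΛ' 0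
    exact ⟨γ', hγ', R, hR, by rw [e', ← e₁, hagree M γ R _ le_rfl hM]⟩
  · rintro _ ⟨γ, hγ, R, hR, rfl⟩
    -- Since `r` is uniform over the hull, it can be fixed before `M`: agreement on the ball of
    -- radius `r + R` contains a full copy of the patch.
    obtain ⟨r, hr⟩ := hΛ'.exists_hull_patch_near hγ hR
    obtain ⟨M, hM⟩ := h (r + R)
    obtain ⟨γ', hγ', hn, e⟩ := hr M 0
    rw [sub_zero] at hn
    refine ⟨γ', ?_, R, hR, by rw [← e, hagree M γ' R _ (by linarith) hM]⟩
    have := (Set.ext_iff.1 hM γ').1 ⟨hγ', by rw [mem_closedBall_zero_iff]; linarith⟩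
    exact this.1

/-- The elements of the internal system contained in the pattern of a compact set form a compact
set. -/
theorem InternalSystem.isCompact_setOf_subset_pattern {Q : Set H} (hQ : IsCompact Q) :
    IsCompact {Λ : InternalSystem S W | Λ.toHull.carrier ⊆ S.pattern Q} := by
  rw [isCompact_iff_ultrafilter_le_nhds]
  intro 𝓕 h𝓕
  rw [le_principal_iff] at h𝓕
  -- The limit is formed site by site. A compact `K` meets the pattern of `Q` in finitely many
  -- sites, so the ultrafilter decides them simultaneously.
  let Λ : Set (PhysicalSpace d) := {x | ∀ᶠ M : InternalSystem S W in 𝓕, x ∈ M.toHull.carrier}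
  have hsub : Λ ⊆ S.pattern Q := fun x hx => by
    obtain ⟨M, hM, hM' : M.toHull.carrier ⊆ S.pattern Q⟩ := (hx.and h𝓕).exists
    exact hM' hM
  have hK : ∀ K : Set (PhysicalSpace d), IsCompact K →
      ∀ᶠ M : InternalSystem S W in 𝓕, M.toHull.carrier ∩ K = Λ ∩ K := by
    intro K hK
    have hfin : (S.pattern Q ∩ K).Finite := by
      refine ((S.finite_lattice_inter hQ hK).image Prod.snd).subset ?_
      rintro _ ⟨⟨p, ⟨hp, hpQ, -⟩, rfl⟩, hpK⟩
      exact ⟨p, ⟨hp, hpQ, hpK⟩, rfl⟩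
    have hev : ∀ᶠ M : InternalSystem S W in 𝓕,
        ∀ x ∈ S.pattern Q ∩ K, (x ∈ M.toHull.carrier ↔ x ∈ Λ) := by
      refine (eventually_all_finite hfin).2 fun x _ => ?_
      by_cases hx : x ∈ Λ
      · filter_upwards [hx] with M hM
        simp [hM, hx]
      · have : ∀ᶠ M : InternalSystem S W in 𝓕, x ∉ M.toHull.carrier :=
          Ultrafilter.eventually_not.2 hx
        filter_upwards [this] with M hM
        simp [hM, hx]
    filter_upwards [hev, h𝓕] with M hM hMQ
    ext x
    refine and_congr_left fun hxK => ⟨fun hx => (hM x ⟨hMQ hx, hxK⟩).1 hx,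
      fun hx => (hM x ⟨hsub hx, hxK⟩).2 hx⟩
  let Λ₀ : InternalSystem S W := ⟨⟨Λ, exists_patternLanguage_eq fun R =>
    ((hK _ (isCompact_closedBall 0 R)).exists.imp' InternalSystem.toHull fun _ h => h)⟩,
    fun x hx => mem_structureGroup_of_mem_pattern (hsub hx)⟩
  refine ⟨Λ₀, hsub, le_nhds_iff.2 fun U hΛU hU => ?_⟩
  obtain ⟨K, hKc, hKU⟩ := hU _ hΛU
  filter_upwards [hK K hKc] with M hM
  exact hKU hM.symm

/-- Translations by elements of `Γ` with internal coordinate in a compact set lie in a compact part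
of the Ellis semigroup of the internal system. -/
theorem exists_isCompact_ellis {C : Set H} (hC : IsCompact C) :
    ∃ A : Set (EllisSemigroup S.structureGroup (InternalSystem S W)), IsCompact A ∧
      ∀ γ : S.structureGroup, (∃ p ∈ S.lattice, -p.1 ∈ C ∧ p.2 = γ) →
        EllisSemigroup.ofGroup γ ∈ A := by
  have key : ∀ Λ : InternalSystem S W, ∃ A : Set (InternalSystem S W), IsCompact A ∧
      ∀ γ : S.structureGroup, (∃ p ∈ S.lattice, -p.1 ∈ C ∧ p.2 = γ) → γ +ᵥ Λ ∈ A := by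
    intro Λ
    obtain ⟨γ₀, hγ₀⟩ := Λ.toHull.carrier_nonempty
    obtain ⟨p₀, hp₀, e₀⟩ := Λ.subset hγ₀
    -- Points of `Λ` have internal coordinate in `p₀.1 + (W - W)`, and translation by `γ` adds `-p.1
    -- ∈ C`.
    let Q : Set H := (fun z : H × H => p₀.1 + (z.1 + z.2)) '' (W.carrier - W.carrier) ×ˢ C
    have hQ : IsCompact Q :=
      (W.isCompact_sub.prod hC).image (continuous_const.add continuous_add)
    refine ⟨_, InternalSystem.isCompact_setOf_subset_pattern hQ, ?_⟩
    rintro γ ⟨p, hp, hpC, e⟩ x hx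
    obtain ⟨q, hq, hqW, eq⟩ := Λ.toHull.exists_lattice_eq_sub hγ₀ (Hull.mem_vadd.1 hx)
    refine ⟨p₀ + (q - p), ⟨S.lattice.add_mem hp₀ (S.lattice.sub_mem hq hp),
      ⟨(q.1, -p.1), ⟨hqW, hpC⟩, by simp [sub_eq_add_neg]⟩, trivial⟩, ?_⟩
    change p₀.2 = γ₀ at e₀
    rw [Prod.snd_add, Prod.snd_sub, e₀, eq, e]
    abel
  choose A hA hAγ using key
  exact ⟨_, EllisSemigroup.isClosedEmbedding_coe.isCompact_preimage (isCompact_univ_pi hA),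
    fun γ hγ Λ _ => hAγ Λ γ hγ⟩

instance : Nonempty (InternalSystem S W) := by
  obtain ⟨Λ, hΛ⟩ := exists_isNonSingularModelSet S W
  exact ⟨hΛ.toHull.exists_eq_vadd.choose.1⟩

/-! ### Bijectivity and compactness of the suspension -/

namespace SuspensionSemigroup

theorem injective_toEllis : Function.Injective (toEllis S W) := by
  intro a b hab
  obtain ⟨g, t, rfl⟩ := exists_mk_eq a
  obtain ⟨g', t', rfl⟩ := exists_mk_eq b
  rw [toEllis_mk, toEllis_mk] at hab
  have h : ∀ Λ, t +ᵥ (g Λ).toHull = t' +ᵥ (g' Λ).toHull := fun Λ => by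
    have := congrArg (fun f => f ((0 : PhysicalSpace d) +ᵥ Λ.toHull)) hab
    simpa only [EllisSemigroup.tildeSub_vadd, add_zero] using this
  -- `Λ.g` and `Λ.g'` are non-empty subsets of `Γ` differing by the translation `t' - t`; one `Λ`
  -- suffices.
  have hγ : t' - t ∈ S.structureGroup := by
    obtain ⟨Λ⟩ := (inferInstance : Nonempty (InternalSystem S W))
    have hΛ : (g Λ).toHull = (t' - t) +ᵥ (g' Λ).toHull := by
      rw [sub_eq_neg_add, add_vadd, ← h, neg_vadd_vadd]
    obtain ⟨x, hx⟩ := (g Λ).toHull.carrier_nonempty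
    have h1 := (g Λ).subset hx
    rw [hΛ] at hx
    have := S.structureGroup.sub_mem ((g' Λ).subset (Hull.mem_vadd.1 hx)) h1
    rwa [add_sub_cancel_left] at this
  refine Quotient.sound ⟨⟨t' - t, hγ⟩, Prod.ext (EllisSemigroup.ext fun Λ => ?_) ?_⟩
  · refine InternalSystem.ext ?_
    change (g' Λ).toHull = -(t' - t) +ᵥ (g Λ).toHull
    rw [neg_sub, sub_eq_neg_add, add_vadd, h, neg_vadd_vadd]
  · change Multiplicative.ofAdd t' = Multiplicative.ofAdd (t + (t' - t))
    rw [add_sub_cancel]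

variable (S W) in
theorem exists_isCompact_image_toEllis : ∃ A : Set (SuspensionSemigroup S W), IsCompact A ∧
    toEllis S W '' A = Set.univ := by
  obtain ⟨C, hC, r, hr⟩ := S.exists_isCompact_cover
  obtain ⟨A, hA, hAC⟩ := exists_isCompact_ellis (S := S) (W := W) hC
  have hc := (hA.prod (isCompact_closedBall (0 : PhysicalSpace d) r)).image continuous_mk
  refine ⟨_, hc, ?_⟩
  have hcl := (hc.image continuous_toEllis).isClosed
  rw [← hcl.closure_eq]
  refine Set.eq_univ_of_forall fun f => closure_mono ?_ (EllisSemigroup.denseRange_ofGroup f)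
  rintro _ ⟨t, rfl⟩
  -- Covering `(0, t)` gives `-p.1 ∈ C` and leaves a remainder `t - p.2` in the ball.
  obtain ⟨p, hp, hpC, hpr⟩ := hr 0 t
  let γ : S.structureGroup := ⟨p.2, p, hp, rfl⟩
  refine ⟨_, ⟨(EllisSemigroup.ofGroup γ, t - p.2), ⟨hAC γ ⟨p, hp, by simpa using hpC, rfl⟩, ?_⟩,
    rfl⟩, ?_⟩
  · simpa using hpr
  · rw [toEllis_mk, EllisSemigroup.tildeSub_ofGroup]
    exact congrArg _ (sub_add_cancel t p.2)

theorem bijective_toEllis : Function.Bijective (toEllis S W) := by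
  refine ⟨injective_toEllis, fun f => ?_⟩
  obtain ⟨A, -, hA⟩ := exists_isCompact_image_toEllis S W
  obtain ⟨a, -, ha⟩ := hA ▸ Set.mem_univ f
  exact ⟨a, ha⟩

/-- By injectivity, a set whose image is everything is the whole space. -/
instance : CompactSpace (SuspensionSemigroup S W) := by
  obtain ⟨A, hA, hu⟩ := exists_isCompact_image_toEllis S W
  refine ⟨?_⟩
  convert hA
  rw [← Set.preimage_image_eq A injective_toEllis, hu, Set.preimage_univ]

end SuspensionSemigroup

end

theorem mainTheorem3 {H : Type*} [AddCommGroup H] [TopologicalSpace H] [IsTopologicalAddGroup H]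
    [LocallyCompactSpace H] [T2Space H] {d : ℕ} (S : CutProjectScheme H d) (W : Window H) :
    ∃ Φ : SuspensionSemigroup S W ≃* EllisSemigroup (PhysicalSpace d) (Hull S W),
      IsHomeomorph Φ ∧
      ∀ (g : EllisSemigroup S.structureGroup (InternalSystem S W)) (t : PhysicalSpace d)
        (Λ : Hull S W), Φ (SuspensionSemigroup.mk g t) Λ = t +ᵥ g.tilde Λ :=
  ⟨MulEquiv.ofBijective (SuspensionSemigroup.toEllis S W) SuspensionSemigroup.bijective_toEllis,
    isHomeomorph_iff_continuous_bijective.2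
      ⟨SuspensionSemigroup.continuous_toEllis, SuspensionSemigroup.bijective_toEllis⟩,
    fun _ _ _ => rfl⟩
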